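/- Let $I=[0,1]\cap\mathbb Z[\tfrac12]$ and let $X$ be the $\mathbb Q$-vector space of functions $I\to\mathbb Q$. For $\alpha\in X$ put $(T_0\alpha)(t)=\alpha(\tfrac t2)$ and $(T_1\alpha)(t)=\alpha(\tfrac{1+t}2)$. The product $\alpha\#\beta\in X$ of $\alpha,\beta\in X$ is defined by recursion on the denominator of the argument: $\alpha\#\beta(0)=0$, $\alpha\#\beta(1)=(\alpha(1)-\alpha(0))(\beta(1)-\beta(0))$, $$\alpha\#\beta(t)=T_0\alpha\#T_0\beta\,(2t)+T_1\alpha\#T_1\beta\,(2t)\qquad(0\le t\le\tfrac12),$$ $$\alpha\#\beta(t)=T_0\alpha\#T_0\beta\,(1)+T_1\alpha\#T_1\beta\,(1)+T_0\alpha\#T_1\beta\,(2t-1)+T_1\alpha\#T_0\beta\,(2t-1)\qquad(\tfrac12\le t\le1).$$ Let $\epsilon\in X$ be $\epsilon(t)=t-t^2$, and define $\phi_0,\phi_1,\phi_2,\dots\in X$ by recursion on the denominator of the argument: $\phi_m(0)=\phi_m(1)=0$; for $0\le t\le\tfrac12$, $$8\phi_m(t)=\begin{cases}\phi_{m+1}(2t)+(8m+6)t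 & (m \text{ even}),\\ \phi_{m-1}(2t)+\epsilon(2t)+(8m+6)t & (m\text{ odd});\end{cases}$$ and for $\tfrac12\le t\le1$, $$8\phi_m(t)=\begin{cases}\phi_0(2t-1)+6(1-t) & (m=0),\\ \phi_{m-1}(2t-1)+\epsilon(2t-1)+(8m+6)(1-t) & (m\ne0\text{ even}),\\ \phi_{m+1}(2t-1)+(8m+6)(1-t) & (m\text{ odd}).\end{cases}$$ **Theorem 2.4.** Let $E_1=\epsilon\#\phi_0$. Then $$\lim_{n\to\infty}2^nE_1(2^{-n})=\frac13+\frac5{14\sqrt7}.$$ Moreover, let $F$ be a field of characteristic $2$. For a power series $f\neq0$ in the maximal ideal of $F[[u_1,\dots,u_r]]$ let $\phi_f\in X$ be the function $\phi_f(i/q)=q^{-r}\dim_F F[[u_1,\dots,u_r]]/(u_1^q,\dots,u_r^q,f^i)$, $q$ a power of $2$ (it is well defined), and let $\mu(f)=\lim_{q=2^n\to\infty}q^{-(r-1)}\dim_F F[[u_1,\dots,u_r]]/(u_1^q,\dots,u_r^q,f)$ be the Hilbert–Kunz multiplicity of $f$. Suppose that the following conjecture (Conjecture 2.3) holds over $F$: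 for $f=x^3+y^3+xyz\in F[[x,y,z]]$ one has $\phi_f(t)=t+\phi_0(t)$ for all $t\in I$. Then the Hilbert–Kunz multiplicity of $uv+x^3+y^3+xyz\in F[[u,v,x,y,z]]$ is $$\mu(uv+x^3+y^3+xyz)=\frac43+\frac5{14\sqrt7}.$$ -/

import Mathlib

open Filter Topology

namespace HilbertKunz

/-- The set `I = [0,1] ∩ ℤ[1/2]` of dyadic rationals in the unit interval. -/
def dyadicUnit : Set ℚ := {t | 0 ≤ t ∧ t ≤ 1 ∧ ∃ (k : ℤ) (n : ℕ), t = k / 2 ^ n}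

/-- The vector space `X` of all functions `I → ℚ`. -/
abbrev X : Type := dyadicUnit → ℚ

/-- The points `0`, `1` and `2⁻ⁿ` of `I`. -/
def zeroPt : dyadicUnit := ⟨0, le_refl 0, zero_le_one, 0, 0, by norm_num⟩

def onePt : dyadicUnit := ⟨1, zero_le_one, le_refl 1, 1, 0, by norm_num⟩

def invTwoPow (n : ℕ) : dyadicUnit :=
  ⟨1 / 2 ^ n, by positivity, by
    rw [div_le_one (by positivity)]
    exact one_le_pow₀ (by norm_num), 1, n, by norm_num⟩

/-- `t ↦ t / 2`. -/
def half (t : dyadicUnit) : dyadicUnit :=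
  ⟨t.1 / 2, by
    obtain ⟨t, h0, h1, k, n, h⟩ := t
    exact ⟨by simp only; linarith, by simp only; linarith, k, n + 1, by
      simp only [h, pow_succ]; field_simp⟩⟩

/-- `t ↦ (1 + t) / 2`. -/
def halfAdd (t : dyadicUnit) : dyadicUnit :=
  ⟨(1 + t.1) / 2, by
    obtain ⟨t, h0, h1, k, n, h⟩ := t
    exact ⟨by simp only; linarith, by simp only; linarith, k + 2 ^ n, n + 1, by
      simp only [h, pow_succ]; push_cast; field_simp; ring⟩⟩

/-- `t ↦ 2t`, for `t ≤ 1/2`. -/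
def dbl (t : dyadicUnit) (ht : t.1 ≤ 1 / 2) : dyadicUnit :=
  ⟨2 * t.1, by
    obtain ⟨t, h0, h1, k, n, h⟩ := t
    simp only at ht
    exact ⟨by simp only; linarith, by simp only; linarith, 2 * k, n, by
      simp only [h]; push_cast; ring⟩⟩

/-- `t ↦ 2t - 1`, for `1/2 ≤ t`. -/
def dblSub (t : dyadicUnit) (ht : 1 / 2 ≤ t.1) : dyadicUnit :=
  ⟨2 * t.1 - 1, by
    obtain ⟨t, h0, h1, k, n, h⟩ := t
    simp only at ht
    exact ⟨by simp only; linarith, by simp only; linarith, 2 * k - 2 ^ n, n, by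
      simp only [h]; push_cast; field_simp⟩⟩

lemma exists_den_eq (t : dyadicUnit) (h0 : t ≠ zeroPt) (h1 : t ≠ onePt) :
    ∃ m : ℕ, t.1.den = 2 ^ (m + 1) := by
  obtain ⟨t, hn, hl, k, n, h⟩ := t
  have h0' : t ≠ 0 := fun e => h0 (Subtype.ext e)
  have h1' : t ≠ 1 := fun e => h1 (Subtype.ext e)
  have hd : t.den ∣ 2 ^ n := by
    have := Rat.den_dvd k (2 ^ n)
    rw [Rat.divInt_eq_div] at this
    push_cast at this
    rw [← h] at this
    exact_mod_cast this
  obtain ⟨m, -, hm⟩ := (Nat.dvd_prime_pow Nat.prime_two).1 hd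
  cases m with
  | succ m => exact ⟨m, hm⟩
  | zero =>
    exfalso
    have e : t = t.num := by
      conv_lhs => rw [← Rat.num_div_den t, hm]
      simp
    rw [e] at hn hl h0' h1'
    norm_cast at hn hl h0' h1'
    omega

lemma den_lt_of_eq {s t : dyadicUnit} (h0 : t ≠ zeroPt) (h1 : t ≠ onePt) (c : ℤ)
    (hs : s.1 = 2 * t.1 - c) : s.1.den < t.1.den := by
  obtain ⟨m, hm⟩ := exists_den_eq t h0 h1
  have e : s.1 = Rat.divInt (t.1.num - c * 2 ^ m) (2 ^ m) := by
    rw [hs, Rat.divInt_eq_div]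
    conv_lhs => rw [← Rat.num_div_den t.1, hm]
    push_cast
    field_simp
    ring
  have hd : s.1.den ∣ 2 ^ m := by
    have := Rat.den_dvd (t.1.num - c * 2 ^ m) (2 ^ m)
    rw [← e] at this
    exact_mod_cast this
  rw [hm, pow_succ]
  have := Nat.le_of_dvd (by positivity) hd
  have : 0 < 2 ^ m := by positivity
  omega

lemma den_dbl_lt {t : dyadicUnit} (h0 : t ≠ zeroPt) (h1 : t ≠ onePt) (ht : t.1 ≤ 1 / 2) :
    (dbl t ht).1.den < t.1.den :=
  den_lt_of_eq h0 h1 0 (by simp [dbl])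

lemma den_dblSub_lt {t : dyadicUnit} (h0 : t ≠ zeroPt) (h1 : t ≠ onePt) (ht : 1 / 2 ≤ t.1) :
    (dblSub t ht).1.den < t.1.den :=
  den_lt_of_eq h0 h1 1 (by simp [dblSub])

lemma den_onePt_lt {t : dyadicUnit} (h0 : t ≠ zeroPt) (h1 : t ≠ onePt) :
    onePt.1.den < t.1.den := by
  obtain ⟨m, hm⟩ := exists_den_eq t h0 h1
  rw [hm]
  exact Nat.one_lt_two_pow (by omega)

/-- `T₀ α` is `t ↦ α (t / 2)`. -/
def T₀ (α : X) : X := fun t => α (half t)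

/-- `T₁ α` is `t ↦ α ((1 + t) / 2)`. -/
def T₁ (α : X) : X := fun t => α (halfAdd t)

/-- The product `α # β` on `X`, by recursion on the denominator of the argument. -/
def sharp (α β : X) (t : dyadicUnit) : ℚ :=
  if h0 : t = zeroPt then 0
  else if h1 : t = onePt then (α onePt - α zeroPt) * (β onePt - β zeroPt)
  else if h : t.1 ≤ 1 / 2 then
    sharp (T₀ α) (T₀ β) (dbl t h) + sharp (T₁ α) (T₁ β) (dbl t h)
  else
    sharp (T₀ α) (T₀ β) onePt + sharp (T₁ α) (T₁ β) onePt
      + sharp (T₀ α) (T₁ β) (dblSub t (le_of_not_ge h))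
      + sharp (T₁ α) (T₀ β) (dblSub t (le_of_not_ge h))
termination_by t.1.den
decreasing_by
  · exact den_dbl_lt h0 h1 h
  · exact den_dbl_lt h0 h1 h
  · exact den_onePt_lt h0 h1
  · exact den_onePt_lt h0 h1
  · exact den_dblSub_lt h0 h1 _
  · exact den_dblSub_lt h0 h1 _

/-- The identity function `t ↦ t` in `X`. -/
def idFun : X := fun t => t.1

/-- The function `ε : t ↦ t - t²` in `X`. -/
def eps : X := fun t => t.1 - t.1 ^ 2

/-- The functions `φ₀, φ₁, φ₂, …` in `X`, by recursion on the denominator of the argument. -/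
def phi (m : ℕ) (t : dyadicUnit) : ℚ :=
  if h0 : t = zeroPt then 0
  else if h1 : t = onePt then 0
  else if h : t.1 ≤ 1 / 2 then
    if Even m then
      (phi (m + 1) (dbl t h) + (8 * m + 6) * t.1) / 8
    else
      (phi (m - 1) (dbl t h) + eps (dbl t h) + (8 * m + 6) * t.1) / 8
  else
    if m = 0 then
      (phi 0 (dblSub t (le_of_not_ge h)) + 6 * (1 - t.1)) / 8
    else if Even m then
      (phi (m - 1) (dblSub t (le_of_not_ge h)) + eps (dblSub t (le_of_not_ge h))
        + (8 * m + 6) * (1 - t.1)) / 8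
    else
      (phi (m + 1) (dblSub t (le_of_not_ge h)) + (8 * m + 6) * (1 - t.1)) / 8
termination_by t.1.den
decreasing_by
  · exact den_dbl_lt h0 h1 h
  · exact den_dbl_lt h0 h1 h
  · exact den_dblSub_lt h0 h1 _
  · exact den_dblSub_lt h0 h1 _
  · exact den_dblSub_lt h0 h1 _

/-- `E₁ = ε # φ₀`. -/
def E₁ : X := sharp eps (phi 0)

section PowerSeries

variable {σ F : Type*} [Fintype σ] [Field F]

/-- The colength `deg (u₁^q, …, u_r^q, g)` in `F[[u₁, …, u_r]]`, as the dimension of the quotient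
over the residue field `F`; the quotient is finite-dimensional for `q > 0`. -/
noncomputable def deg (q : ℕ) (g : MvPowerSeries σ F) : ℕ :=
  Module.finrank F (MvPowerSeries σ F ⧸
    (Ideal.span (Set.range fun j : σ => (MvPowerSeries.X j : MvPowerSeries σ F) ^ q)
      ⊔ Ideal.span {g}))

/-- The function `φ_f : i/q ↦ q^{-r} deg (u₁^q, …, u_r^q, f^i)` in `X`, where `r` is the number
of variables and `i/q` is taken in lowest terms (so that `q` is a power of `2`). -/
noncomputable def hkFun (f : MvPowerSeries σ F) : X := fun t =>
  (deg t.1.den (f ^ t.1.num.toNat) : ℚ) / (t.1.den : ℚ) ^ Fintype.card σ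

/-- `μ` is the Hilbert-Kunz multiplicity of `f`, a nonzero nonunit power series in `r` variables
over a field of characteristic `2`: the limit of `q^{-(r-1)} deg (u₁^q, …, u_r^q, f)` over the
powers `q = 2ⁿ`. -/
def HasHKMultiplicity (f : MvPowerSeries σ F) (μ : ℝ) : Prop :=
  Tendsto (fun n : ℕ => (deg (2 ^ n) f : ℝ) / ((2 : ℝ) ^ n) ^ (Fintype.card σ - 1)) atTop (𝓝 μ)

end PowerSeries

/-- The nodal cubic `x³ + y³ + xyz` in `F[[x, y, z]]`. -/
noncomputable def nodalCubic (F : Type*) [Field F] : MvPowerSeries (Fin 3) F :=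
  let x := MvPowerSeries.X 0
  let y := MvPowerSeries.X 1
  let z := MvPowerSeries.X 2
  x ^ 3 + y ^ 3 + x * y * z

/-- The element `uv + x³ + y³ + xyz` of `F[[u, v, x, y, z]]`. -/
noncomputable def uvNodalCubic (F : Type*) [Field F] : MvPowerSeries (Fin 5) F :=
  let u := MvPowerSeries.X 0
  let v := MvPowerSeries.X 1
  let x := MvPowerSeries.X 2
  let y := MvPowerSeries.X 3
  let z := MvPowerSeries.X 4
  u * v + x ^ 3 + y ^ 3 + x * y * z

/-- The conjecture on the nodal cubic over `F`: `φ_f = t + φ₀` for `f = x³ + y³ + xyz`. -/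
def NodalCubicConjecture (F : Type*) [Field F] : Prop :=
  hkFun (nodalCubic F) = idFun + phi 0

end HilbertKunz

/-! Unrolling the recursion for `sharp` at `2⁻ⁿ` gives a sum of products of increments over the
dyadic grid of mesh `2⁻ⁿ`. The increments of `ε` there are `(2ⁿ - 1 - 2k) / 4ⁿ`, so Abel summation
turns `2ⁿ E₁(2⁻ⁿ)` into twice the Riemann sum of `φ₀` (`E₁_invTwoPow`). The functional equations of
the `φ_m` make the limits `a_m` of the doubled Riemann sums satisfy `16 a₀ = a₁ + a₀ + 6` and `16
a_m = a_{m+1} + a_{m-1} + 1/3 + 8m + 6` for `m ≥ 1`. The solution of linear growth is `phiLimit`,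
and the recursion contracts the distance to it (`abs_sub_phiLimit_le`); `a₀ = 1/3 + 5/(14√7)`.

For the multiplicity, grade by the difference of the exponents of `u` and `v`. Modulo `uv - f`, each
diagonal collapses to a single copy of `F[[x, y, z]]` modulo a power of `f`, so the colength is a
sum of colengths of `f, f², …` (`deg_uv_sub`). Under the conjecture, with `q = 2ⁿ`, this sum is `q³
(q + 2 ∑ φ₀(k/q))`. Division by `q⁴` leaves `1` plus the sequence already treated. -/

namespace HilbertKunz

/-! ### Dyadic points and the product at `2⁻ⁿ`. -/

/-- The point `k / 2ⁿ` of `I`, with `k` truncated at `2ⁿ`. -/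
def pt (n k : ℕ) : dyadicUnit :=
  ⟨(min k (2 ^ n) : ℕ) / 2 ^ n, by positivity, by
    rw [div_le_one (by positivity)]
    exact_mod_cast min_le_right _ _, (min k (2 ^ n) : ℕ), n, by push_cast; rfl⟩

lemma coe_pt {n k : ℕ} (h : k ≤ 2 ^ n) : (pt n k).1 = k / 2 ^ n := by
  simp [pt, min_eq_left h]

lemma pt_zero (n : ℕ) : pt n 0 = zeroPt := Subtype.ext (by rw [coe_pt (Nat.zero_le _)]; simp [zeroPt])

lemma pt_two_pow (n : ℕ) : pt n (2 ^ n) = onePt :=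
  Subtype.ext (by rw [coe_pt le_rfl]; simp [onePt])

lemma half_pt {n k : ℕ} (h : k ≤ 2 ^ n) : half (pt n k) = pt (n + 1) k :=
  Subtype.ext (by
    have h' : k ≤ 2 ^ (n + 1) := by rw [pow_succ]; omega
    rw [coe_pt h']
    simp only [half, coe_pt h, pow_succ]
    field_simp)

lemma halfAdd_pt {n k : ℕ} (h : k ≤ 2 ^ n) : halfAdd (pt n k) = pt (n + 1) (2 ^ n + k) :=
  Subtype.ext (by
    have h' : 2 ^ n + k ≤ 2 ^ (n + 1) := by rw [pow_succ]; omega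
    rw [coe_pt h']
    simp only [halfAdd, coe_pt h, pow_succ]
    push_cast
    field_simp)

lemma dbl_half (t : dyadicUnit) (h : (half t).1 ≤ 1 / 2) : dbl (half t) h = t :=
  Subtype.ext (by simp only [dbl, half]; ring)

lemma dblSub_halfAdd (t : dyadicUnit) (h : 1 / 2 ≤ (halfAdd t).1) : dblSub (halfAdd t) h = t :=
  Subtype.ext (by simp only [dblSub, halfAdd]; ring)

lemma half_le (t : dyadicUnit) : (half t).1 ≤ 1 / 2 := by
  have := t.2.2.1
  simp only [half]
  linarith

lemma le_halfAdd (t : dyadicUnit) : 1 / 2 ≤ (halfAdd t).1 := by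
  have := t.2.1
  simp only [halfAdd]
  linarith

lemma half_ne_onePt (t : dyadicUnit) : half t ≠ onePt := fun e => by
  have := half_le t
  rw [e] at this
  norm_num [onePt] at this

lemma halfAdd_ne_zeroPt (t : dyadicUnit) : halfAdd t ≠ zeroPt := fun e => by
  have := le_halfAdd t
  rw [e] at this
  norm_num [zeroPt] at this

lemma invTwoPow_zero : invTwoPow 0 = onePt := Subtype.ext (by simp [invTwoPow, onePt])

lemma invTwoPow_succ (n : ℕ) : invTwoPow (n + 1) = half (invTwoPow n) :=
  Subtype.ext (by simp only [invTwoPow, half, pow_succ]; field_simp)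

lemma invTwoPow_ne_zeroPt (n : ℕ) : invTwoPow n ≠ zeroPt := fun e => by
  have := congrArg Subtype.val e
  simp [invTwoPow, zeroPt] at this

/-- Only the branch `t ≤ 1/2` of the recursion is met on the way from `2⁻ⁿ` to `1`. Its two terms
are the sums over the left and right halves of the grid. -/
lemma sharp_invTwoPow (n : ℕ) (α β : X) :
    sharp α β (invTwoPow n) = ∑ k ∈ Finset.range (2 ^ n),
      (α (pt n (k + 1)) - α (pt n k)) * (β (pt n (k + 1)) - β (pt n k)) := by
  induction n generalizing α β with
  | zero =>
    have h1 : pt 0 1 = onePt := pt_two_pow 0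
    have h0 : onePt ≠ zeroPt := invTwoPow_zero ▸ invTwoPow_ne_zeroPt 0
    rw [sharp]
    simp [invTwoPow_zero, h0, pt_zero, h1]
  | succ n ih =>
    have h0 := invTwoPow_ne_zeroPt (n + 1)
    have h1 : invTwoPow (n + 1) ≠ onePt := by rw [invTwoPow_succ]; exact half_ne_onePt _
    have h : (invTwoPow (n + 1)).1 ≤ 1 / 2 := by rw [invTwoPow_succ]; exact half_le _
    have hd : dbl (invTwoPow (n + 1)) h = invTwoPow n := by
      simp only [invTwoPow_succ, dbl_half]
    rw [sharp, dif_neg h0, dif_neg h1, dif_pos h, hd, ih, ih, pow_succ, mul_two,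
      Finset.sum_range_add]
    congr 1 <;> refine Finset.sum_congr rfl fun k hk => ?_
    · have hk := Finset.mem_range.1 hk
      simp only [T₀, half_pt hk.le, half_pt (Nat.succ_le_of_lt hk)]
    · have hk := Finset.mem_range.1 hk
      simp only [T₁, halfAdd_pt hk.le, halfAdd_pt (Nat.succ_le_of_lt hk), add_assoc]

/-! ### Functional equations of the `φ_m`. -/

lemma phi_zeroPt (m : ℕ) : phi m zeroPt = 0 := by rw [phi]; simp

lemma phi_onePt (m : ℕ) : phi m onePt = 0 := by rw [phi]; simp

lemma eps_zeroPt : eps zeroPt = 0 := by simp [eps, zeroPt]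

lemma eps_onePt : eps onePt = 0 := by simp [eps, onePt]

lemma phi_half (m : ℕ) (t : dyadicUnit) :
    phi m (half t) = ((if Even m then phi (m + 1) t else phi (m - 1) t + eps t)
      + (4 * m + 3) * t.1) / 8 := by
  by_cases h0 : half t = zeroPt
  · have ht : t = zeroPt := Subtype.ext (by
      have := congrArg Subtype.val h0
      simp only [half, zeroPt] at this ⊢
      linarith)
    subst ht
    rw [h0]
    simp only [phi_zeroPt, eps_zeroPt]
    simp [zeroPt]
  · rw [phi, dif_neg h0, dif_neg (half_ne_onePt t), dif_pos (half_le t)]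
    simp only [dbl_half]
    have : (half t).1 = t.1 / 2 := rfl
    split_ifs <;> rw [this] <;> ring

lemma phi_halfAdd (m : ℕ) (t : dyadicUnit) :
    phi m (halfAdd t) = ((if m = 0 then phi 0 t else if Even m then phi (m - 1) t + eps t
      else phi (m + 1) t) + (4 * m + 3) * (1 - t.1)) / 8 := by
  by_cases h0 : halfAdd t = onePt
  · have ht : t = onePt := Subtype.ext (by
      have := congrArg Subtype.val h0
      simp only [halfAdd, onePt] at this ⊢
      linarith)
    subst ht
    rw [h0]
    simp only [phi_onePt, eps_onePt]
    simp [onePt]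
  -- At the midpoint `phi` takes its left branch. Both branches give `(4m + 3)/8` there, because `φ`
  -- and `ε` vanish at the endpoints.
  by_cases h : (halfAdd t).1 ≤ 1 / 2
  · have ht : t = zeroPt := Subtype.ext (by
      have := t.2.1
      simp only [halfAdd, zeroPt] at h ⊢
      linarith)
    subst ht
    have hh : halfAdd zeroPt = half onePt := Subtype.ext (by simp [halfAdd, half, zeroPt, onePt])
    rw [hh, phi_half]
    simp only [phi_zeroPt, eps_zeroPt, phi_onePt, eps_onePt]
    simp [zeroPt, onePt]
  · rw [phi, dif_neg (halfAdd_ne_zeroPt t), dif_neg h0, dif_neg h]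
    simp only [dblSub_halfAdd]
    have : (halfAdd t).1 = (1 + t.1) / 2 := rfl
    split_ifs with hm
    · subst hm; rw [this]; push_cast; ring
    all_goals rw [this]; ring

/-! ### Dyadic sums and their recursions. -/

/-- The sum of `α (k / 2ⁿ)` over `0 ≤ k < 2ⁿ`. -/
def dyadicSum (α : X) (n : ℕ) : ℚ := ∑ k ∈ Finset.range (2 ^ n), α (pt n k)

lemma dyadicSum_succ (α : X) (n : ℕ) :
    dyadicSum α (n + 1) = dyadicSum (T₀ α) n + dyadicSum (T₁ α) n := by
  rw [dyadicSum, pow_succ, mul_two, Finset.sum_range_add]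
  congr 1 <;> refine Finset.sum_congr rfl fun k hk => ?_
  · rw [T₀, half_pt (Finset.mem_range.1 hk).le]
  · rw [T₁, halfAdd_pt (Finset.mem_range.1 hk).le]

lemma dyadicSum_idFun (n : ℕ) : dyadicSum idFun n = (2 ^ n - 1) / 2 := by
  induction n with
  | zero => simp [dyadicSum, idFun, pt_zero, zeroPt]
  | succ n ih =>
    have h0 : dyadicSum (T₀ idFun) n = dyadicSum idFun n / 2 := by
      simp only [dyadicSum, Finset.sum_div]; rfl
    have h1 : dyadicSum (T₁ idFun) n = (2 ^ n + dyadicSum idFun n) / 2 := by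
      have (t : dyadicUnit) : T₁ idFun t = (1 + idFun t) / 2 := rfl
      simp only [dyadicSum, this, ← Finset.sum_div, Finset.sum_add_distrib]
      simp
    rw [dyadicSum_succ, h0, h1, ih, pow_succ]
    ring

lemma dyadicSum_eps (n : ℕ) : dyadicSum eps n = (2 ^ n - 1 / 2 ^ n) / 6 := by
  induction n with
  | zero => simp [dyadicSum, eps, pt_zero, zeroPt]
  | succ n ih =>
    have h0 : dyadicSum (T₀ eps) n = (dyadicSum eps n + dyadicSum idFun n) / 4 := by
      have (t : dyadicUnit) : T₀ eps t = (eps t + idFun t) / 4 := by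
        simp only [T₀, eps, half, idFun]; ring
      simp only [dyadicSum, this, ← Finset.sum_div, Finset.sum_add_distrib]
    have h1 : dyadicSum (T₁ eps) n = (dyadicSum eps n + 2 ^ n - dyadicSum idFun n) / 4 := by
      have (t : dyadicUnit) : T₁ eps t = (eps t + 1 - idFun t) / 4 := by
        simp only [T₁, eps, halfAdd, idFun]; ring
      simp only [dyadicSum, this, ← Finset.sum_div, Finset.sum_add_distrib,
        Finset.sum_sub_distrib]
      simp
    rw [dyadicSum_succ, h0, h1, ih, pow_succ]
    field_simp
    ring

lemma dyadicSum_T₀_phi (m n : ℕ) :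
    dyadicSum (T₀ (phi m)) n = ((if Even m then dyadicSum (phi (m + 1)) n
      else dyadicSum (phi (m - 1)) n + dyadicSum eps n) + (4 * m + 3) * dyadicSum idFun n) / 8 := by
  split_ifs with h <;>
    simp only [dyadicSum, T₀, phi_half, h, if_true, if_false, ← Finset.sum_div,
      Finset.sum_add_distrib, Finset.mul_sum] <;> rfl

lemma dyadicSum_T₁_phi (m n : ℕ) :
    dyadicSum (T₁ (phi m)) n = ((if m = 0 then dyadicSum (phi 0) n
      else if Even m then dyadicSum (phi (m - 1)) n + dyadicSum eps n
      else dyadicSum (phi (m + 1)) n) + (4 * m + 3) * (2 ^ n - dyadicSum idFun n)) / 8 := by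
  split_ifs with h0 h <;>
    simp only [dyadicSum, T₁, phi_halfAdd, *, if_true, if_false, ← Finset.sum_div,
      Finset.sum_add_distrib, ← Finset.mul_sum, Finset.sum_sub_distrib] <;> simp [idFun]

lemma dyadicSum_phi_zero (n : ℕ) :
    dyadicSum (phi 0) (n + 1)
      = (dyadicSum (phi 1) n + dyadicSum (phi 0) n + 3 * 2 ^ n) / 8 := by
  rw [dyadicSum_succ, dyadicSum_T₀_phi, dyadicSum_T₁_phi]
  simp
  ring

/-- One half of the interval contributes `φ_{m+2}`, the other `φ_m + ε`; parity decides only which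
is which, so it drops out. The terms in `t` and `1 - t` add up to a constant. -/
lemma dyadicSum_phi_succ (m n : ℕ) :
    dyadicSum (phi (m + 1)) (n + 1)
      = (dyadicSum (phi (m + 2)) n + dyadicSum (phi m) n + dyadicSum eps n
        + (4 * m + 7) * 2 ^ n) / 8 := by
  rw [dyadicSum_succ, dyadicSum_T₀_phi, dyadicSum_T₁_phi]
  rw [if_neg m.succ_ne_zero]
  split_ifs <;> simp <;> ring

/-- Summation by parts. In the application `c = M - 1` and `b` vanishes at both ends, so only the
last sum survives. -/
lemma sum_mul_sub (b : ℕ → ℚ) (c : ℚ) (M : ℕ) :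
    ∑ k ∈ Finset.range M, (c - 2 * k) * (b (k + 1) - b k)
      = (c - 2 * M + 2) * b M - (c + 2) * b 0 + 2 * ∑ k ∈ Finset.range M, b k := by
  induction M with
  | zero => simp
  | succ M ih =>
    rw [Finset.sum_range_succ, Finset.sum_range_succ, ih]
    push_cast
    ring

lemma E₁_invTwoPow (n : ℕ) : E₁ (invTwoPow n) = 2 * dyadicSum (phi 0) n / (2 ^ n) ^ 2 := by
  have h := sum_mul_sub (fun k => phi 0 (pt n k)) (2 ^ n - 1) (2 ^ n)
  simp only [pt_two_pow, pt_zero, phi_onePt, phi_zeroPt, mul_zero, sub_zero, zero_add] at h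
  rw [E₁, sharp_invTwoPow, dyadicSum, ← h, Finset.sum_div]
  refine Finset.sum_congr rfl fun k hk => ?_
  have hk := Finset.mem_range.1 hk
  simp only [eps, coe_pt hk.le, coe_pt (Nat.succ_le_of_lt hk)]
  push_cast
  field_simp
  ring

/-! ### The limiting linear recurrence and convergence to its solution. -/

/-- The limit of `2 * dyadicSum (phi m) n / 2ⁿ` for `n → ∞`. -/
noncomputable def phiLimit (m : ℕ) : ℝ :=
  4 / 7 * m + 19 / 42 + 5 * (3 * √7 - 7) / 294 * (8 - 3 * √7) ^ m

lemma phiLimit_zero : phiLimit 0 = 1 / 3 + 5 / (14 * √7) := by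
  have h : √7 ^ 2 = (7 : ℝ) := Real.sq_sqrt (by norm_num)
  have h0 : √7 ≠ (0 : ℝ) := by positivity
  simp only [phiLimit]
  field_simp
  push_cast
  linear_combination 185220 * h

/-- This boundary equation fixes the coefficient `5(3√7 - 7)/294` of the geometric term in
`phiLimit`. -/
lemma sixteen_mul_phiLimit_zero : 16 * phiLimit 0 = phiLimit 1 + phiLimit 0 + 6 := by
  have h : √7 ^ 2 = (7 : ℝ) := Real.sq_sqrt (by norm_num)
  simp only [phiLimit]
  push_cast
  linear_combination (45 / 294) * h

/-- The affine part of `phiLimit` is a particular solution, and `8 - 3√7` is a root of `x² - 16x +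
1`. The other root `8 + 3√7` exceeds `1` and would violate the linear bound `abs_phiLimit_le`. -/
lemma sixteen_mul_phiLimit_succ (m : ℕ) :
    16 * phiLimit (m + 1) = phiLimit (m + 2) + phiLimit m + 1 / 3 + (8 * m + 14) := by
  have h : √7 ^ 2 = (7 : ℝ) := Real.sq_sqrt (by norm_num)
  simp only [phiLimit]
  push_cast
  linear_combination (-9 * (5 * (3 * √7 - 7) / 294 * (8 - 3 * √7) ^ m)) * h

lemma abs_phiLimit_le (m : ℕ) : |phiLimit m| ≤ 2 * (m + 1) := by
  have h : √7 ^ 2 = (7 : ℝ) := Real.sq_sqrt (by norm_num)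
  have h0 : (0 : ℝ) ≤ √7 := by positivity
  have h1 : √7 ≤ (8 / 3 : ℝ) := by nlinarith
  have h2 : (7 / 3 : ℝ) ≤ √7 := by nlinarith
  have h3 : (0 : ℝ) ≤ (8 - 3 * √7) ^ m := pow_nonneg (by linarith) _
  have h4 : (8 - 3 * √7 : ℝ) ^ m ≤ 1 := pow_le_one₀ (by linarith) (by linarith)
  have h5 : (0 : ℝ) ≤ 5 * (3 * √7 - 7) / 294 := by linarith
  have h6 : 5 * (3 * √7 - 7) / 294 * (8 - 3 * √7 : ℝ) ^ m ≤ 5 * (3 * √7 - 7) / 294 :=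
    mul_le_of_le_one_right h5 h4
  have h7 := mul_nonneg h5 h3
  have hm : (0 : ℝ) ≤ m := m.cast_nonneg
  rw [phiLimit, abs_of_nonneg (by linarith)]
  linarith

/-- The error at `(m, n + 1)` involves those at `m ± 1`, so all `m` are treated together with the
weight `2(m + 1)`. This weight is affine, so averaging two neighbours over `16` shrinks the bound by
`8`; only a factor `2` is needed, which leaves room for the error of the Riemann sum of `ε`. -/
lemma abs_sub_phiLimit_le (m n : ℕ) :
    |2 * (dyadicSum (phi m) n : ℝ) / 2 ^ n - phiLimit m| ≤ 2 * (m + 1) * (1 / 2) ^ n := by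
  induction n generalizing m with
  | zero =>
    -- For `n = 0` the only grid point is `0`, so the error is `phiLimit m` itself.
    have : dyadicSum (phi m) 0 = 0 := by simp [dyadicSum, pt_zero, phi_zeroPt]
    simpa [this] using abs_phiLimit_le m
  | succ n ih =>
    have hp : (0 : ℝ) < (1 / 2) ^ n := by positivity
    cases m with
    | zero =>
      have i0 := abs_le.1 (ih 0)
      have i1 := abs_le.1 (ih 1)
      have e := sixteen_mul_phiLimit_zero
      have : 2 * (dyadicSum (phi 0) (n + 1) : ℝ) / 2 ^ (n + 1)
          = (2 * (dyadicSum (phi 1) n : ℝ) / 2 ^ n + 2 * (dyadicSum (phi 0) n : ℝ) / 2 ^ n + 6)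
            / 16 := by
        rw [dyadicSum_phi_zero]
        push_cast
        field_simp
        ring
      rw [this, pow_succ (1 / 2 : ℝ) n]
      push_cast at i0 i1 ⊢
      have hq0 := sq_nonneg ((1 / 2 : ℝ) ^ n)
      generalize (1 / 2 : ℝ) ^ n = p at *
      rw [abs_le]
      constructor <;> linarith
    | succ m =>
      have i0 := abs_le.1 (ih m)
      have i1 := abs_le.1 (ih (m + 2))
      have e := sixteen_mul_phiLimit_succ m
      have : 2 * (dyadicSum (phi (m + 1)) (n + 1) : ℝ) / 2 ^ (n + 1)
          = (2 * (dyadicSum (phi (m + 2)) n : ℝ) / 2 ^ n + 2 * (dyadicSum (phi m) n : ℝ) / 2 ^ n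
            + (1 - ((1 / 2) ^ n) ^ 2) / 3 + (8 * m + 14)) / 16 := by
        rw [dyadicSum_phi_succ, dyadicSum_eps]
        push_cast
        rw [one_div_pow]
        field_simp
        ring
      -- The sum of `ε` falls short of its limit by a multiple of `4⁻ⁿ`, which is absorbed into the
      -- bound of order `2⁻ⁿ`.
      have hq : ((1 / 2 : ℝ) ^ n) ^ 2 ≤ (1 / 2) ^ n := by
        rw [sq]
        exact mul_le_of_le_one_right hp.le (pow_le_one₀ (by norm_num) (by norm_num))
      have hm : 0 ≤ (m : ℝ) * (1 / 2) ^ n := by positivity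
      rw [this, pow_succ (1 / 2 : ℝ) n]
      push_cast at i0 i1 ⊢
      have hq0 := sq_nonneg ((1 / 2 : ℝ) ^ n)
      generalize (1 / 2 : ℝ) ^ n = p at *
      rw [abs_le]
      constructor <;> linarith

lemma tendsto_dyadicSum_phi (m : ℕ) :
    Tendsto (fun n : ℕ => 2 * (dyadicSum (phi m) n : ℝ) / 2 ^ n) atTop (𝓝 (phiLimit m)) := by
  rw [tendsto_iff_norm_sub_tendsto_zero]
  refine squeeze_zero (fun _ => norm_nonneg _) (fun n => abs_sub_phiLimit_le m n) ?_
  simpa using (tendsto_pow_atTop_nhds_zero_of_lt_one (r := (1 / 2 : ℝ)) (by norm_num)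
    (by norm_num)).const_mul (2 * ((m : ℝ) + 1))

lemma tendsto_E₁ :
    Tendsto (fun n : ℕ => (2 : ℝ) ^ n * (E₁ (invTwoPow n) : ℝ)) atTop
      (𝓝 (1 / 3 + 5 / (14 * √7))) := by
  rw [← phiLimit_zero]
  refine (tendsto_dyadicSum_phi 0).congr fun n => ?_
  rw [E₁_invTwoPow]
  push_cast
  field_simp

/-! ### Splitting a quotient into a direct sum. -/

section LinearAlgebra

variable {F R S ι : Type*} [Field F] [CommRing R] [CommRing S] [Algebra F R] [Algebra F S]

/-- The maps `Ψ` and `Θ` induce inverse isomorphisms between `R ⧸ I` and the product of the `S ⧸ K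
d`. The lemma serves twice: for residue classes of exponents and for diagonals in `u, v`. -/
lemma finrank_quotient_eq_sum [Fintype ι] (I : Ideal R) (K : ι → Ideal S)
    [∀ d, Module.Finite F (S ⧸ K d)] (Ψ : ι → R →ₗ[F] S) (Θ : ι → S →ₗ[F] R)
    (hΨ : ∀ d, ∀ g ∈ I, Ψ d g ∈ K d) (hΘ : ∀ d, ∀ m ∈ K d, Θ d m ∈ I)
    (hself : ∀ d m, Ψ d (Θ d m) = m) (hne : ∀ d d', d ≠ d' → ∀ m, Ψ d (Θ d' m) = 0)
    (hsum : ∀ g, g - ∑ d, Θ d (Ψ d g) ∈ I) :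
    Module.finrank F (R ⧸ I) = ∑ d, Module.finrank F (S ⧸ K d) := by
  classical
  let L : R →ₗ[F] (∀ d, S ⧸ K d) :=
    LinearMap.pi fun d => (Ideal.Quotient.mkₐ F (K d)).toLinearMap ∘ₗ Ψ d
  have hL (g : R) (d : ι) : L g d = Ideal.Quotient.mk (K d) (Ψ d g) := rfl
  have hker : LinearMap.ker L = I.restrictScalars F := by
    ext g
    rw [LinearMap.mem_ker, Submodule.restrictScalars_mem]
    constructor
    · intro h
      have h' (d : ι) : Ψ d g ∈ K d := by
        rw [← Ideal.Quotient.eq_zero_iff_mem, ← hL, h, Pi.zero_apply]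
      have := I.add_mem (hsum g) (I.sum_mem fun d (_ : d ∈ Finset.univ) => hΘ d _ (h' d))
      rwa [sub_add_cancel] at this
    · intro h
      ext d
      rw [hL, Pi.zero_apply, Ideal.Quotient.eq_zero_iff_mem]
      exact hΨ d g h
  have hsurj : Function.Surjective L := by
    intro y
    choose m hm using fun d => Ideal.Quotient.mk_surjective (y d)
    refine ⟨∑ d, Θ d (m d), funext fun d => ?_⟩
    rw [hL, map_sum, Finset.sum_eq_single d (fun d' _ h => hne d d' h.symm _)
      (fun h => absurd (Finset.mem_univ d) h), hself, hm]
  rw [← Module.finrank_pi_fintype F, ← (L.quotKerEquivOfSurjective hsurj).finrank_eq, hker]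
  exact ((Submodule.Quotient.restrictScalarsEquiv F I).finrank_eq).symm

end LinearAlgebra

/-! ### The ideal of `q`-th powers of the variables. -/

section PowIdeal

variable {σ F : Type*} [Field F]

/-- The ideal generated by the `q`-th powers of the variables. -/
noncomputable def powIdeal (σ F : Type*) [Field F] (q : ℕ) : Ideal (MvPowerSeries σ F) :=
  Ideal.span (Set.range fun j : σ => (MvPowerSeries.X j : MvPowerSeries σ F) ^ q)

lemma X_pow_mem_powIdeal (q : ℕ) (j : σ) :
    (MvPowerSeries.X j : MvPowerSeries σ F) ^ q ∈ powIdeal σ F q :=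
  Ideal.subset_span ⟨j, rfl⟩

lemma coeff_eq_zero_of_mem_powIdeal {q : ℕ} {g : MvPowerSeries σ F} (hg : g ∈ powIdeal σ F q)
    (m : σ →₀ ℕ) (hm : ∀ j, m j < q) : MvPowerSeries.coeff m g = 0 := by
  classical
  induction hg using Submodule.span_induction generalizing m with
  | mem x hx =>
    obtain ⟨j, rfl⟩ := hx
    exact MvPowerSeries.X_pow_dvd_iff.1 dvd_rfl m (hm j)
  | zero => simp
  | add x y _ _ hx hy => rw [map_add, hx m hm, hy m hm, add_zero]
  | smul a x _ hx =>
    rw [smul_eq_mul, MvPowerSeries.coeff_mul]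
    refine Finset.sum_eq_zero fun p hp => ?_
    rw [hx p.2 fun j => ?_, mul_zero]
    rw [← Finset.HasAntidiagonal.mem_antidiagonal.1 hp] at hm
    exact (Nat.le_add_left _ _).trans_lt (hm j)

lemma mem_powIdeal_iff [Finite σ] {q : ℕ} {g : MvPowerSeries σ F} :
    g ∈ powIdeal σ F q ↔ ∀ m : σ →₀ ℕ, (∀ j, m j < q) → MvPowerSeries.coeff m g = 0 := by
  classical
  refine ⟨coeff_eq_zero_of_mem_powIdeal, ?_⟩
  have := Fintype.ofFinite σ
  -- Induction on the set of constrained variables: for each new variable `X_j`, split off the terms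
  -- divisible by `X_j ^ q`. With no constraint left, all coefficients vanish.
  suffices H : ∀ s : Finset σ, ∀ g : MvPowerSeries σ F,
      (∀ m : σ →₀ ℕ, (∀ j ∈ s, m j < q) → MvPowerSeries.coeff m g = 0) → g ∈ powIdeal σ F q by
    intro h
    exact H Finset.univ g fun m hm => h m fun j => hm j (Finset.mem_univ j)
  intro s
  induction s using Finset.induction_on with
  | empty =>
    intro g h
    have : g = 0 := MvPowerSeries.ext fun m => by simpa using h m (by simp)
    exact this ▸ Ideal.zero_mem _
  | insert j s _ ih =>
    intro g h
    let g₁ : MvPowerSeries σ F := fun m => if m j < q then 0 else MvPowerSeries.coeff m g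
    have hg₁ (m : σ →₀ ℕ) : MvPowerSeries.coeff m g₁
        = if m j < q then 0 else MvPowerSeries.coeff m g := rfl
    have h₁ : g₁ ∈ powIdeal σ F q := by
      obtain ⟨c, hc⟩ := MvPowerSeries.X_pow_dvd_iff.2
        fun m (hm : m j < q) => (hg₁ m).trans (if_pos hm)
      rw [hc]
      exact Ideal.mul_mem_right _ _ (X_pow_mem_powIdeal q j)
    have h₂ : g - g₁ ∈ powIdeal σ F q := by
      refine ih _ fun m hm => ?_
      rw [map_sub, hg₁]
      split_ifs with hj
      · rw [sub_zero]
        exact h m fun i hi => (Finset.mem_insert.1 hi).elim (fun e => e ▸ hj) (hm i)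
      · exact sub_self _
    simpa using Ideal.add_mem _ h₂ h₁

instance finite_quotient_powIdeal [Finite σ] (q : ℕ) :
    Module.Finite F (MvPowerSeries σ F ⧸ powIdeal σ F q) := by
  have hfin : Finite {m : σ →₀ ℕ // ∀ j, m j < q} := by
    refine Finite.of_injective (fun m (j : σ) => (⟨m.1 j, m.2 j⟩ : Fin q)) fun m m' h => ?_
    refine Subtype.ext (Finsupp.ext fun j => ?_)
    simpa using congrFun h j
  let L : MvPowerSeries σ F →ₗ[F] ({m : σ →₀ ℕ // ∀ j, m j < q} → F) :=
    LinearMap.pi fun m => MvPowerSeries.coeff m.1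
  have hker : (powIdeal σ F q).restrictScalars F = LinearMap.ker L := by
    ext g
    rw [Submodule.restrictScalars_mem, mem_powIdeal_iff, LinearMap.mem_ker, funext_iff]
    exact ⟨fun h m => h m.1 m.2, fun h m hm => h ⟨m, hm⟩⟩
  have h1 : Module.Finite F (MvPowerSeries σ F ⧸ LinearMap.ker L) :=
    Module.Finite.equiv L.quotKerEquivRange.symm
  rw [← hker] at h1
  exact Module.Finite.equiv (Submodule.Quotient.restrictScalarsEquiv F (powIdeal σ F q))

instance finite_quotient_powIdeal_sup [Finite σ] (q : ℕ) (I : Ideal (MvPowerSeries σ F)) :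
    Module.Finite F (MvPowerSeries σ F ⧸ (powIdeal σ F q ⊔ I)) :=
  Module.Finite.of_surjective
    (Ideal.Quotient.factorₐ F (le_sup_left : powIdeal σ F q ≤ powIdeal σ F q ⊔ I)).toLinearMap
    (Ideal.Quotient.factor_surjective le_sup_left)

lemma deg_eq [Fintype σ] (q : ℕ) (g : MvPowerSeries σ F) :
    deg q g = Module.finrank F (MvPowerSeries σ F ⧸ (powIdeal σ F q ⊔ Ideal.span {g})) := rfl

end PowIdeal

/-! ### Substituting `Q`-th powers: power series split by exponents modulo `Q`. -/

section Expand

variable {σ F : Type*} [Fintype σ] [Field F] {Q : ℕ}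

/-- The exponent vector of a tuple of residues. -/
noncomputable def residueExp (e : σ → Fin Q) : σ →₀ ℕ :=
  Finsupp.equivFunOnFinite.symm fun s => (e s : ℕ)

@[simp] lemma residueExp_apply (e : σ → Fin Q) (s : σ) : residueExp e s = e s := rfl

/-- The power series whose coefficients are those of `g` at the exponents congruent to `e`
modulo `Q`. -/
noncomputable def residueSection (e : σ → Fin Q) : MvPowerSeries σ F →ₗ[F] MvPowerSeries σ F :=
  LinearMap.pi fun m => MvPowerSeries.coeff (Q • m + residueExp e)

lemma coeff_residueSection (e : σ → Fin Q) (g : MvPowerSeries σ F) (m : σ →₀ ℕ) :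
    MvPowerSeries.coeff m (residueSection e g) = MvPowerSeries.coeff (Q • m + residueExp e) g := rfl

lemma coeff_expand_of_not_exists (hQ : Q ≠ 0) (p : MvPowerSeries σ F) (m : σ →₀ ℕ)
    (h : ∀ m', m ≠ Q • m') : MvPowerSeries.coeff m (MvPowerSeries.expand Q hQ p) = 0 := by
  by_contra hc
  have (i : σ) : Q ∣ m i := by
    by_contra hi
    exact hc (MvPowerSeries.coeff_expand_of_not_dvd Q hQ p hi)
  choose f hf using this
  exact h (Finsupp.equivFunOnFinite.symm f) (Finsupp.ext fun i => by simp [hf])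

/-- Multiplication by a series in the `Q`-th powers preserves residue classes of exponents, so only
multiples of `Q` in its support matter in the convolution. -/
lemma residueSectionexpand_mul (hQ : Q ≠ 0) (e : σ → Fin Q) (p g : MvPowerSeries σ F) :
    residueSection e (MvPowerSeries.expand Q hQ p * g) = p * residueSection e g := by
  classical
  ext m
  rw [coeff_residueSection, MvPowerSeries.coeff_mul, MvPowerSeries.coeff_mul]
  symm
  refine Finset.sum_of_injOn (fun x => (Q • x.1, Q • x.2 + residueExp e)) ?_ ?_ ?_ ?_
  · rintro ⟨i, j⟩ _ ⟨i', j'⟩ _ h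
    simp only [Prod.mk.injEq, add_left_inj] at h
    have hinj : ∀ x y : σ →₀ ℕ, Q • x = Q • y → x = y := fun x y hxy => Finsupp.ext fun s => by
      have := DFunLike.congr_fun hxy s
      simpa [hQ] using this
    rw [hinj _ _ h.1, hinj _ _ h.2]
  · rintro ⟨i, j⟩ h
    simp only [Finset.mem_coe, Finset.HasAntidiagonal.mem_antidiagonal] at h ⊢
    rw [← h, smul_add, add_assoc]
  · rintro ⟨i, j⟩ h hij
    by_cases hi : ∃ i', i = Q • i'
    · obtain ⟨i', rfl⟩ := hi
      exfalso
      rw [Finset.HasAntidiagonal.mem_antidiagonal] at h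
      have h' (s : σ) : Q * i' s + j s = Q * m s + e s := by
        simpa using DFunLike.congr_fun h s
      -- The residue `e s` is less than `Q`, so `Q i' ≤ Q m + e` already forces `i' ≤ m`.
      have hle : i' ≤ m := fun s => by
        have := h' s
        have he := (e s).2
        by_contra hlt
        have : Q * (m s + 1) ≤ Q * i' s := Nat.mul_le_mul_left _ (by omega)
        rw [mul_add] at this
        omega
      refine hij ⟨(i', m - i'), by simp [add_tsub_cancel_of_le hle], ?_⟩
      simp only [Prod.mk.injEq, true_and]
      refine Finsupp.ext fun s => ?_
      have := h' s
      have := Nat.mul_le_mul_left Q (hle s)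
      simp only [Finsupp.add_apply, Finsupp.smul_apply, Finsupp.tsub_apply, smul_eq_mul,
        Nat.mul_sub, residueExp_apply]
      omega
    · push Not at hi
      rw [coeff_expand_of_not_exists hQ p i hi, zero_mul]
  · rintro ⟨i, j⟩ _
    simp only [MvPowerSeries.coeff_expand_smul, coeff_residueSection]

/-- Right inverse to `residueSection`, supported on the exponents congruent to `e` modulo `Q`. -/
noncomputable def residueInsert (hQ : Q ≠ 0) (e : σ → Fin Q) :
    MvPowerSeries σ F →ₗ[F] MvPowerSeries σ F :=
  LinearMap.mulLeft F (MvPowerSeries.monomial (residueExp e) 1)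
    ∘ₗ (MvPowerSeries.expand Q hQ).toLinearMap

lemma residueInsert_apply (hQ : Q ≠ 0) (e : σ → Fin Q) (g : MvPowerSeries σ F) :
    residueInsert hQ e g = MvPowerSeries.monomial (residueExp e) 1 * MvPowerSeries.expand Q hQ g := rfl

lemma coeff_residueInsert_same (hQ : Q ≠ 0) (e : σ → Fin Q) (g : MvPowerSeries σ F) (m : σ →₀ ℕ) :
    MvPowerSeries.coeff (Q • m + residueExp e) (residueInsert hQ e g) = MvPowerSeries.coeff m g := by
  rw [residueInsert_apply, add_comm, MvPowerSeries.coeff_add_monomial_mul, one_mul,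
    MvPowerSeries.coeff_expand_smul]

lemma coeff_residueInsert_ne (hQ : Q ≠ 0) {e e' : σ → Fin Q} (h : e ≠ e') (g : MvPowerSeries σ F)
    (m : σ →₀ ℕ) :
    MvPowerSeries.coeff (Q • m + residueExp e) (residueInsert hQ e' g) = 0 := by
  rw [residueInsert_apply, MvPowerSeries.coeff_monomial_mul]
  split_ifs with hle
  · rw [one_mul]
    refine coeff_expand_of_not_exists hQ _ _ fun m' hm' => h (funext fun s => Fin.ext ?_)
    have h1 := DFunLike.congr_fun hm' s
    have h2 := hle s
    simp only [Finsupp.tsub_apply, Finsupp.add_apply, Finsupp.smul_apply, smul_eq_mul,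
      residueExp_apply] at h1 h2
    have h3 : Q * m s + e s = Q * m' s + e' s := by omega
    have := congrArg (· % Q) h3
    simpa [Nat.mod_eq_of_lt (e s).2, Nat.mod_eq_of_lt (e' s).2] using this
  · rfl

lemma exists_residueExp (hQ : Q ≠ 0) (m : σ →₀ ℕ) :
    ∃ (m' : σ →₀ ℕ) (e : σ → Fin Q), m = Q • m' + residueExp e :=
  ⟨Finsupp.equivFunOnFinite.symm fun s => m s / Q,
    fun s => ⟨m s % Q, Nat.mod_lt _ (Nat.pos_of_ne_zero hQ)⟩,
    Finsupp.ext fun s => by simp [Nat.div_add_mod]⟩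

/-- Substituting the `Q`-th powers of the `r` variables for them multiplies colengths by `Qʳ`. -/
lemma deg_expand (hQ : Q ≠ 0) (q : ℕ) (p : MvPowerSeries σ F) :
    deg (Q * q) (MvPowerSeries.expand Q hQ p) = Q ^ Fintype.card σ * deg q p := by
  classical
  rw [deg_eq, finrank_quotient_eq_sum (ι := σ → Fin Q) _
    (fun _ => powIdeal σ F q ⊔ Ideal.span {p}) residueSection (residueInsert hQ)]
  · simp [deg_eq]
  · intro e g hg
    obtain ⟨g₁, h₁, g₂, h₂, rfl⟩ := Submodule.mem_sup.1 hg
    obtain ⟨c, rfl⟩ := Ideal.mem_span_singleton'.1 h₂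
    rw [map_add, mul_comm c, residueSectionexpand_mul]
    refine Ideal.add_mem _ (Ideal.mem_sup_left ?_)
      (Ideal.mem_sup_right (Ideal.mul_mem_right _ _ (Ideal.mem_span_singleton_self p)))
    rw [mem_powIdeal_iff]
    intro m hm
    rw [coeff_residueSection]
    refine coeff_eq_zero_of_mem_powIdeal h₁ _ fun j => ?_
    have := Nat.mul_le_mul_left Q (Nat.succ_le_of_lt (hm j))
    have := (e j).2
    simp only [Finsupp.add_apply, Finsupp.smul_apply, smul_eq_mul, residueExp_apply]
    rw [Nat.succ_eq_add_one, mul_add] at *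
    omega
  · intro e m hm
    rw [residueInsert_apply]
    refine Ideal.mul_mem_left _ _ ?_
    suffices H : powIdeal σ F q ⊔ Ideal.span {p} ≤
        (powIdeal σ F (Q * q) ⊔ Ideal.span {MvPowerSeries.expand Q hQ p}).comap
          (MvPowerSeries.expand Q hQ) from H hm
    refine sup_le (Ideal.span_le.2 ?_) (Ideal.span_le.2 ?_)
    · rintro _ ⟨j, rfl⟩
      refine Ideal.mem_sup_left ?_
      rw [map_pow, MvPowerSeries.expand_X, ← pow_mul]
      exact X_pow_mem_powIdeal _ j
    · rintro _ rfl
      exact Ideal.mem_sup_right (Ideal.mem_span_singleton_self _)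
  · intro e g
    ext m
    rw [coeff_residueSection, coeff_residueInsert_same]
  · intro e e' h g
    ext m
    rw [coeff_residueSection, coeff_residueInsert_ne hQ h, map_zero]
  · intro g
    convert Ideal.zero_mem _
    ext m
    obtain ⟨m, e, rfl⟩ := exists_residueExp hQ m
    rw [map_sub, map_sum, Finset.sum_eq_single e
      (fun e' _ h => coeff_residueInsert_ne hQ h.symm _ _) (fun h => absurd (Finset.mem_univ e) h),
      coeff_residueInsert_same, coeff_residueSection, sub_self, map_zero]

end Expand

/-! ### The colength of `uv - f`, diagonal by diagonal. -/

section TwoMoreVariables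

variable {F : Type*} [Field F] {r : ℕ}

/-- The coefficient of `uᵃ vᵇ` of a power series in `u`, `v` and `r` further variables. -/
noncomputable def coeffUV (a b : ℕ) :
    MvPowerSeries (Fin (r + 1 + 1)) F →ₗ[F] MvPowerSeries (Fin r) F where
  toFun g := PowerSeries.coeff b (MvPowerSeries.finSuccEquiv F r
    (PowerSeries.coeff a (MvPowerSeries.finSuccEquiv F (r + 1) g)))
  map_add' g h := by simp only [map_add]
  map_smul' c g := by
    ext m
    rw [RingHom.id_apply, MvPowerSeries.coeff_smul]
    simp only [MvPowerSeries.coeff_coeff_finSuccEquiv, MvPowerSeries.coeff_smul]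

lemma coeffUV_apply (a b : ℕ) (g : MvPowerSeries (Fin (r + 1 + 1)) F) :
    coeffUV a b g = PowerSeries.coeff b (MvPowerSeries.finSuccEquiv F r
      (PowerSeries.coeff a (MvPowerSeries.finSuccEquiv F (r + 1) g))) := rfl

lemma coeff_coeffUV (a b : ℕ) (g : MvPowerSeries (Fin (r + 1 + 1)) F) (m : Fin r →₀ ℕ) :
    MvPowerSeries.coeff m (coeffUV a b g) = MvPowerSeries.coeff ((m.cons b).cons a) g := by
  rw [coeffUV_apply, MvPowerSeries.coeff_coeff_finSuccEquiv, MvPowerSeries.coeff_coeff_finSuccEquiv]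

/-- The inclusion of the power series in the last `r` variables. -/
noncomputable def inclLast : MvPowerSeries (Fin r) F →ₐ[F] MvPowerSeries (Fin (r + 1 + 1)) F :=
  (MvPowerSeries.rename (Fin.succEmb (r + 1))).comp (MvPowerSeries.rename (Fin.succEmb r))

lemma finSuccEquiv_rename_succ (p : MvPowerSeries (Fin r) F) :
    MvPowerSeries.finSuccEquiv F r (MvPowerSeries.rename (Fin.succEmb r) p) = PowerSeries.C p := by
  ext k m
  rw [MvPowerSeries.coeff_coeff_finSuccEquiv, PowerSeries.coeff_C]
  split_ifs with hk
  · subst hk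
    have : m.cons 0 = m.embDomain (Fin.succEmb r) := by
      ext i
      refine Fin.cases ?_ (fun i => ?_) i
      · rw [Finsupp.cons_zero, Finsupp.embDomain_of_notMem_range]
        rintro ⟨j, hj⟩
        exact Fin.succ_ne_zero j hj
      · rw [Finsupp.cons_succ]
        exact (Finsupp.embDomain_apply_self (Fin.succEmb r) m i).symm
    rw [this, MvPowerSeries.coeff_embDomain_rename]
  · rw [MvPowerSeries.coeff_rename_eq_zero, map_zero]
    rintro ⟨m', hm'⟩
    have := DFunLike.congr_fun hm' 0
    rw [Finsupp.cons_zero, Finsupp.mapDomain_of_notMem_range] at this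
    · exact hk this.symm
    · rintro ⟨j, hj⟩
      exact Fin.succ_ne_zero j hj

lemma inclLast_X (j : Fin r) :
    inclLast (MvPowerSeries.X j : MvPowerSeries (Fin r) F) = MvPowerSeries.X j.succ.succ := by
  simp [inclLast]

lemma coeffUV_inclLast_mul (a b : ℕ) (p : MvPowerSeries (Fin r) F)
    (g : MvPowerSeries (Fin (r + 1 + 1)) F) :
    coeffUV a b (inclLast p * g) = p * coeffUV a b g := by
  simp only [coeffUV_apply, inclLast, AlgHom.comp_apply, map_mul, finSuccEquiv_rename_succ,
    PowerSeries.coeff_C_mul]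

lemma coeffUV_X_pow_mul (a b i j : ℕ) (g : MvPowerSeries (Fin (r + 1 + 1)) F) :
    coeffUV a b (MvPowerSeries.X 0 ^ i * MvPowerSeries.X 1 ^ j * g)
      = if i ≤ a ∧ j ≤ b then coeffUV (a - i) (b - j) g else 0 := by
  have h1 : MvPowerSeries.finSuccEquiv F (r + 1) (MvPowerSeries.X 1)
      = PowerSeries.C (MvPowerSeries.X 0) := MvPowerSeries.finSuccEquiv_X_succ (R := F) 0
  rw [coeffUV_apply, mul_assoc, map_mul, map_pow, MvPowerSeries.finSuccEquiv_X_zero,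
    PowerSeries.coeff_X_pow_mul']
  by_cases hi : i ≤ a
  · rw [if_pos hi, map_mul, map_pow, h1, ← map_pow, PowerSeries.coeff_C_mul, map_mul, map_pow,
      MvPowerSeries.finSuccEquiv_X_zero, PowerSeries.coeff_X_pow_mul']
    simp only [hi, true_and, coeffUV_apply]
  · simp [hi]

lemma coeffUV_inclLast (a b : ℕ) (p : MvPowerSeries (Fin r) F) :
    coeffUV a b (inclLast p) = if a = 0 ∧ b = 0 then p else 0 := by
  simp only [coeffUV_apply, inclLast, AlgHom.comp_apply, finSuccEquiv_rename_succ,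
    PowerSeries.coeff_C]
  by_cases ha : a = 0
  · simp only [ha, if_true, finSuccEquiv_rename_succ, PowerSeries.coeff_C, true_and]
  · simp [ha]

lemma coeffUV_X_pow_mul_inclLast (a b i j : ℕ) (p : MvPowerSeries (Fin r) F) :
    coeffUV a b (MvPowerSeries.X 0 ^ i * MvPowerSeries.X 1 ^ j * inclLast p)
      = if a = i ∧ b = j then p else 0 := by
  rw [coeffUV_X_pow_mul, coeffUV_inclLast, ← ite_and]
  congr 1
  exact propext (by omega)

lemma mem_powIdeal_iff_coeffUV {q : ℕ} {g : MvPowerSeries (Fin (r + 1 + 1)) F} :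
    g ∈ powIdeal (Fin (r + 1 + 1)) F q
      ↔ ∀ a < q, ∀ b < q, coeffUV a b g ∈ powIdeal (Fin r) F q := by
  simp only [mem_powIdeal_iff, coeff_coeffUV]
  constructor
  · intro h a ha b hb m hm
    refine h _ fun j => Fin.cases ?_ (fun j => Fin.cases ?_ (fun j => ?_) j) j
    · simpa using ha
    · rw [Finsupp.cons_succ, Finsupp.cons_zero]
      exact hb
    · simpa using hm j
  · intro h m hm
    have := h (m 0) (hm 0) (m.tail 0) (hm _) m.tail.tail fun j => hm _
    rwa [Finsupp.cons_tail, Finsupp.cons_tail] at this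

/-- The sum telescopes: multiplication by `uv - f` turns the coefficient at `(i, j)` into the one at
`(i - 1, j - 1)` minus `f` times the old one. As `a` or `b` is `0`, the first term has no
predecessor. -/
lemma sum_pow_mul_coeffUV (f : MvPowerSeries (Fin r) F) (a b k : ℕ) (hab : a = 0 ∨ b = 0)
    (g : MvPowerSeries (Fin (r + 1 + 1)) F) :
    ∑ j ∈ Finset.range (k + 1), f ^ j * coeffUV (a + j) (b + j)
      ((MvPowerSeries.X 0 * MvPowerSeries.X 1 - inclLast f) * g)
      = -(f ^ (k + 1) * coeffUV (a + k) (b + k) g) := by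
  have h (i j : ℕ) : coeffUV i j ((MvPowerSeries.X 0 * MvPowerSeries.X 1 - inclLast f) * g)
      = (if 1 ≤ i ∧ 1 ≤ j then coeffUV (i - 1) (j - 1) g else 0) - f * coeffUV i j g := by
    rw [sub_mul, map_sub, coeffUV_inclLast_mul]
    simpa using coeffUV_X_pow_mul i j 1 1 g
  induction k with
  | zero =>
    rw [Finset.sum_range_one, h, if_neg (by omega)]
    simp
  | succ k ih =>
    rw [Finset.sum_range_succ, ih, h, if_pos (by omega), ← add_assoc, ← add_assoc,
      Nat.add_sub_cancel, Nat.add_sub_cancel]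
    ring

/-- Indices for the differences `a - b`, where `0 ≤ a, b < q`: `inl d` stands for `d`, and
`inr d` for `-(d + 1)`. -/
abbrev DiagIndex (q : ℕ) : Type := Fin q ⊕ Fin (q - 1)

variable {q : ℕ}

/-- The exponent of `u` in the first monomial of a diagonal. -/
def DiagIndex.fst : DiagIndex q → ℕ
  | .inl i => i
  | .inr _ => 0

/-- The exponent of `v` in the first monomial of a diagonal. -/
def DiagIndex.snd : DiagIndex q → ℕ
  | .inl _ => 0
  | .inr i => i + 1

/-- The number of monomials on a diagonal. -/
def DiagIndex.len : DiagIndex q → ℕ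
  | .inl i => q - i
  | .inr i => q - 1 - i

lemma DiagIndex.fst_eq_zero_or (d : DiagIndex q) : d.fst = 0 ∨ d.snd = 0 := by
  cases d <;> simp [fst, snd]

lemma DiagIndex.len_pos (d : DiagIndex q) : 0 < d.len := by
  rcases d with i | i <;> have := i.2 <;> simp only [len] <;> omega

lemma DiagIndex.fst_add_lt (d : DiagIndex q) {j : ℕ} (hj : j < d.len) : d.fst + j < q := by
  rcases d with i | i <;> simp only [len, fst] at * <;> omega

lemma DiagIndex.snd_add_lt (d : DiagIndex q) {j : ℕ} (hj : j < d.len) : d.snd + j < q := by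
  rcases d with i | i <;> simp only [len, snd] at * <;> omega

lemma DiagIndex.add_len (d : DiagIndex q) : d.fst + d.len = q ∨ d.snd + d.len = q := by
  rcases d with i | i <;> have := i.2 <;> simp only [len, fst, snd] <;> omega

lemma DiagIndex.eq_of_add_eq {d d' : DiagIndex q} {j j' : ℕ} (h : d.fst + j = d'.fst + j')
    (h' : d.snd + j = d'.snd + j') : d = d' ∧ j = j' := by
  rcases d with i | i <;> rcases d' with i' | i' <;>
    simp only [fst, snd, reduceCtorEq, false_and, Sum.inl.injEq, Sum.inr.injEq, Fin.ext_iff] at * <;>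
    omega

lemma DiagIndex.exists_add_eq {a b : ℕ} (ha : a < q) (hb : b < q) :
    ∃ (d : DiagIndex q) (j : ℕ), j < d.len ∧ d.fst + j = a ∧ d.snd + j = b := by
  rcases le_or_gt b a with h | h
  · exact ⟨.inl ⟨a - b, by omega⟩, b, by simp only [len]; omega, by simp only [fst]; omega,
      by simp only [snd]; omega⟩
  · exact ⟨.inr ⟨b - a - 1, by omega⟩, a, by simp only [len]; omega, by simp only [fst]; omega,
      by simp only [snd]; omega⟩

lemma DiagIndex.sum_len (h : ℕ → ℕ) :
    ∑ d : DiagIndex q, h d.len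
      = ∑ k ∈ Finset.range q, h (k + 1) + ∑ k ∈ Finset.range (q - 1), h (k + 1) := by
  rw [Fintype.sum_sum_type, ← Finset.sum_range_reflect _ q, ← Finset.sum_range_reflect _ (q - 1),
    Finset.sum_range, Finset.sum_range]
  congr 1 <;> refine Finset.sum_congr rfl fun i _ => ?_ <;> have := i.2 <;> simp only [len] <;>
    congr 1 <;> omega

/-- The sum of `fʲ n_j` over the coefficients `n_j` on a diagonal. -/
noncomputable def diagSum (f : MvPowerSeries (Fin r) F) (d : DiagIndex q) :
    MvPowerSeries (Fin (r + 1 + 1)) F →ₗ[F] MvPowerSeries (Fin r) F :=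
  ∑ j ∈ Finset.range d.len, LinearMap.mulLeft F (f ^ j) ∘ₗ coeffUV (d.fst + j) (d.snd + j)

lemma diagSum_apply (f : MvPowerSeries (Fin r) F) (d : DiagIndex q)
    (g : MvPowerSeries (Fin (r + 1 + 1)) F) :
    diagSum f d g = ∑ j ∈ Finset.range d.len, f ^ j * coeffUV (d.fst + j) (d.snd + j) g := by
  simp [diagSum]

/-- Insertion at the first monomial of a diagonal. -/
noncomputable def diagInsert (d : DiagIndex q) :
    MvPowerSeries (Fin r) F →ₗ[F] MvPowerSeries (Fin (r + 1 + 1)) F :=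
  LinearMap.mulLeft F (MvPowerSeries.X 0 ^ d.fst * MvPowerSeries.X 1 ^ d.snd)
    ∘ₗ inclLast.toLinearMap

lemma diagInsert_apply (d : DiagIndex q) (p : MvPowerSeries (Fin r) F) :
    diagInsert d p = MvPowerSeries.X 0 ^ d.fst * MvPowerSeries.X 1 ^ d.snd * inclLast p := rfl

/-- The ideal `(uᵠ, vᵠ, …, uv - f)`. -/
noncomputable def uvIdeal (q : ℕ) (f : MvPowerSeries (Fin r) F) :
    Ideal (MvPowerSeries (Fin (r + 1 + 1)) F) :=
  powIdeal _ F q ⊔ Ideal.span {MvPowerSeries.X 0 * MvPowerSeries.X 1 - inclLast f}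

lemma mul_inclLast_pow_sub_mem (f : MvPowerSeries (Fin r) F) (k : ℕ)
    (g h : MvPowerSeries (Fin (r + 1 + 1)) F) :
    g * ((MvPowerSeries.X 0 * MvPowerSeries.X 1) ^ k - inclLast f ^ k) * h ∈ uvIdeal q f :=
  Ideal.mem_sup_right (Ideal.mul_mem_right _ _ (Ideal.mul_mem_left _ _
    (Ideal.mem_span_singleton.2 (sub_dvd_pow_sub_pow _ _ k))))

/-- Telescoping along a whole diagonal leaves a multiple of `f ^ d.len`, which is why this power
appears. -/
lemma diagSum_mem (f : MvPowerSeries (Fin r) F) (d : DiagIndex q)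
    {g : MvPowerSeries (Fin (r + 1 + 1)) F} (hg : g ∈ uvIdeal q f) :
    diagSum f d g ∈ powIdeal (Fin r) F q ⊔ Ideal.span {f ^ d.len} := by
  obtain ⟨g₁, h₁, g₂, h₂, rfl⟩ := Submodule.mem_sup.1 hg
  obtain ⟨c, rfl⟩ := Ideal.mem_span_singleton'.1 h₂
  rw [map_add]
  refine Ideal.add_mem _ (Ideal.mem_sup_left ?_) (Ideal.mem_sup_right ?_)
  · rw [diagSum_apply]
    refine Ideal.sum_mem _ fun j hj => Ideal.mul_mem_left _ _ ?_
    have hj := Finset.mem_range.1 hj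
    exact mem_powIdeal_iff_coeffUV.1 h₁ _ (d.fst_add_lt hj) _ (d.snd_add_lt hj)
  · obtain ⟨k, hk⟩ := Nat.exists_eq_succ_of_ne_zero d.len_pos.ne'
    rw [diagSum_apply, mul_comm c, hk, Nat.succ_eq_add_one,
      sum_pow_mul_coeffUV f _ _ k d.fst_eq_zero_or]
    exact (Ideal.neg_mem_iff _).2 (Ideal.mul_mem_right _ _ (Ideal.mem_span_singleton_self _))

/-- Modulo `uv - f`, the factor `f ^ d.len` may be traded for `(uv) ^ d.len`; from the start of the
diagonal this reaches `u ^ q` or `v ^ q`. -/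
lemma diagInsert_mem (f : MvPowerSeries (Fin r) F) (d : DiagIndex q)
    {p : MvPowerSeries (Fin r) F} (hp : p ∈ powIdeal (Fin r) F q ⊔ Ideal.span {f ^ d.len}) :
    diagInsert d p ∈ uvIdeal q f := by
  rw [diagInsert_apply]
  obtain ⟨p₁, h₁, p₂, h₂, rfl⟩ := Submodule.mem_sup.1 hp
  obtain ⟨c, rfl⟩ := Ideal.mem_span_singleton'.1 h₂
  rw [map_add, mul_add]
  refine Ideal.add_mem _ (Ideal.mem_sup_left ?_) ?_
  · rw [mem_powIdeal_iff_coeffUV]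
    intro a _ b _
    rw [coeffUV_X_pow_mul_inclLast]
    split_ifs
    exacts [h₁, Ideal.zero_mem _]
  · have h := mul_inclLast_pow_sub_mem (q := q) f d.len
      (MvPowerSeries.X 0 ^ d.fst * MvPowerSeries.X 1 ^ d.snd) (inclLast c)
    have h' : MvPowerSeries.X 0 ^ d.fst * MvPowerSeries.X 1 ^ d.snd
        * (MvPowerSeries.X 0 * MvPowerSeries.X 1) ^ d.len * inclLast c ∈ uvIdeal q f := by
      have e : MvPowerSeries.X 0 ^ d.fst * MvPowerSeries.X 1 ^ d.snd
          * (MvPowerSeries.X 0 * MvPowerSeries.X 1) ^ d.len * inclLast c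
          = (MvPowerSeries.X 0 ^ (d.fst + d.len) * MvPowerSeries.X 1 ^ (d.snd + d.len)
            * inclLast c : MvPowerSeries (Fin (r + 1 + 1)) F) := by ring
      rw [e]
      refine Ideal.mem_sup_left (Ideal.mul_mem_right _ _ ?_)
      rcases d.add_len with hd | hd
      · exact Ideal.mul_mem_right _ _ (by rw [hd]; exact X_pow_mem_powIdeal _ _)
      · exact Ideal.mul_mem_left _ _ (by rw [hd]; exact X_pow_mem_powIdeal _ _)
    have := Ideal.sub_mem _ h' h
    convert this using 1
    rw [map_mul, map_pow]
    ring

lemma sub_sum_diagInsert_mem (f : MvPowerSeries (Fin r) F)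
    (g : MvPowerSeries (Fin (r + 1 + 1)) F) :
    g - ∑ d : DiagIndex q, diagInsert d (diagSum f d g) ∈ uvIdeal q f := by
  let mon (i j : ℕ) : MvPowerSeries (Fin (r + 1 + 1)) F :=
    MvPowerSeries.X 0 ^ i * MvPowerSeries.X 1 ^ j
  let c (d : DiagIndex q) (j : ℕ) : MvPowerSeries (Fin (r + 1 + 1)) F :=
    inclLast (coeffUV (d.fst + j) (d.snd + j) g)
  -- First congruence: drop the monomials divisible by `u ^ q` or `v ^ q`. The second, `h₂`,
  -- replaces `(uv) ^ j` by `f ^ j` along each diagonal.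
  have h₁ : g - ∑ d : DiagIndex q, ∑ j ∈ Finset.range d.len, mon (d.fst + j) (d.snd + j) * c d j
      ∈ uvIdeal q f := by
    refine Ideal.mem_sup_left (mem_powIdeal_iff_coeffUV.2 fun a ha b hb => ?_)
    obtain ⟨d, j, hj, rfl, rfl⟩ := DiagIndex.exists_add_eq ha hb
    convert Ideal.zero_mem _
    simp only [map_sub, map_sum, mon, c, coeffUV_X_pow_mul_inclLast]
    rw [Finset.sum_eq_single d, Finset.sum_eq_single j, if_pos ⟨rfl, rfl⟩, sub_self]
    · intro j' _ hne
      exact if_neg fun h => hne (by omega)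
    · exact fun h => absurd (Finset.mem_range.2 hj) h
    · intro d' _ hne
      exact Finset.sum_eq_zero fun j' _ =>
        if_neg fun h => hne (DiagIndex.eq_of_add_eq h.1 h.2).1.symm
    · exact fun h => absurd (Finset.mem_univ d) h
  have h₂ : ∑ d : DiagIndex q, ∑ j ∈ Finset.range d.len, mon d.fst d.snd
      * ((MvPowerSeries.X 0 * MvPowerSeries.X 1) ^ j - inclLast f ^ j) * c d j ∈ uvIdeal q f :=
    Ideal.sum_mem _ fun d _ => Ideal.sum_mem _ fun j _ => mul_inclLast_pow_sub_mem f j _ _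
  convert Ideal.add_mem _ h₁ h₂ using 1
  rw [sub_add, ← Finset.sum_sub_distrib]
  congr 1
  refine Finset.sum_congr rfl fun d _ => ?_
  rw [← Finset.sum_sub_distrib, diagInsert_apply, diagSum_apply, map_sum, Finset.mul_sum]
  refine Finset.sum_congr rfl fun j _ => ?_
  simp only [mon, c, map_mul, map_pow]
  ring

/-- The colength of `uv - f` is the sum of those of the powers of `f` over all diagonals. -/
lemma deg_uv_sub (q : ℕ) (f : MvPowerSeries (Fin r) F) :
    deg q (MvPowerSeries.X 0 * MvPowerSeries.X 1 - inclLast f)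
      = ∑ k ∈ Finset.range q, deg q (f ^ (k + 1))
        + ∑ k ∈ Finset.range (q - 1), deg q (f ^ (k + 1)) := by
  rw [← DiagIndex.sum_len fun k => deg q (f ^ k)]
  refine finrank_quotient_eq_sum (uvIdeal q f)
    (fun d : DiagIndex q => powIdeal (Fin r) F q ⊔ Ideal.span {f ^ d.len}) (diagSum f) diagInsert
    (fun d g hg => diagSum_mem f d hg) (fun d p hp => diagInsert_mem f d hp) ?_ ?_
    (sub_sum_diagInsert_mem f)
  · intro d p
    rw [diagSum_apply, diagInsert_apply, Finset.sum_eq_single 0]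
    · simp [coeffUV_X_pow_mul_inclLast]
    · intro j _ hj
      rw [coeffUV_X_pow_mul_inclLast, if_neg (by omega), mul_zero]
    · exact fun h => absurd (Finset.mem_range.2 d.len_pos) h
  · intro d d' hne p
    rw [diagSum_apply, diagInsert_apply]
    refine Finset.sum_eq_zero fun j _ => ?_
    rw [coeffUV_X_pow_mul_inclLast, if_neg, mul_zero]
    exact fun h => hne (DiagIndex.eq_of_add_eq (j' := 0) h.1 h.2).1

end TwoMoreVariables

/-! ### The nodal cubic in characteristic 2. -/

section NodalCubic

variable {F : Type*} [Field F]

lemma deg_neg_pow {σ : Type*} [Fintype σ] (q k : ℕ) (f : MvPowerSeries σ F) :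
    deg q ((-f) ^ k) = deg q (f ^ k) := by
  rw [deg_eq, deg_eq]
  rcases Nat.even_or_odd k with h | h
  · rw [h.neg_pow]
  · rw [h.neg_pow, Ideal.span_singleton_neg]

lemma uvNodalCubic_eq :
    uvNodalCubic F = MvPowerSeries.X 0 * MvPowerSeries.X 1 - inclLast (-nodalCubic F) := by
  have h (j : Fin 3) := inclLast_X (F := F) j
  have h0 := h 0
  have h1 := h 1
  have h2 := h 2
  simp only [uvNodalCubic, nodalCubic, map_neg, map_add, map_mul, map_pow, h0, h1, h2]
  rw [sub_neg_eq_add]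
  simp only [add_assoc]
  rfl

/-- The colength of `uv + f` for the nodal cubic `f`. -/
lemma deg_uvNodalCubic (q : ℕ) :
    deg q (uvNodalCubic F) = ∑ k ∈ Finset.range q, deg q (nodalCubic F ^ (k + 1))
      + ∑ k ∈ Finset.range (q - 1), deg q (nodalCubic F ^ (k + 1)) := by
  rw [uvNodalCubic_eq, deg_uv_sub]
  simp only [deg_neg_pow]

variable [CharP F 2]

/-- All coefficients are `1`, hence fixed by Frobenius, so no assumption on `F` beyond the
characteristic is needed. -/
lemma expand_nodalCubic (n : ℕ) :
    MvPowerSeries.expand (2 ^ n) (by positivity) (nodalCubic F) = nodalCubic F ^ 2 ^ n := by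
  have : CharP (MvPowerSeries (Fin 3) F) 2 :=
    charP_of_injective_algebraMap (algebraMap F (MvPowerSeries (Fin 3) F)).injective 2
  simp only [nodalCubic, map_add, map_mul, map_pow, MvPowerSeries.expand_X,
    add_pow_char_pow, mul_pow, ← pow_mul, mul_comm (2 ^ n)]

lemma deg_nodalCubic_pow_mul (n q i : ℕ) :
    deg (2 ^ n * q) (nodalCubic F ^ (2 ^ n * i)) = (2 ^ n) ^ 3 * deg q (nodalCubic F ^ i) := by
  have h := deg_expand (Q := 2 ^ n) (by positivity) q (nodalCubic F ^ i)
  rwa [map_pow, expand_nodalCubic, ← pow_mul, Fintype.card_fin] at h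

/-- `hkFun` may be computed at `k / 2ⁿ` without passing to lowest terms. -/
lemma deg_nodalCubic_pow {n k : ℕ} (hk : k ≤ 2 ^ n) :
    (deg (2 ^ n) (nodalCubic F ^ k) : ℚ) = (2 ^ n) ^ 3 * hkFun (nodalCubic F) (pt n k) := by
  have hc := coe_pt hk
  have hd : (pt n k).1.den ∣ 2 ^ n := by
    have := Rat.den_dvd k (2 ^ n)
    rw [Rat.divInt_eq_div] at this
    push_cast at this
    rw [← hc] at this
    exact_mod_cast this
  obtain ⟨m, hm, hden⟩ := (Nat.dvd_prime_pow Nat.prime_two).1 hd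
  obtain ⟨c, rfl⟩ := Nat.exists_eq_add_of_le' hm
  have hnum : ((pt (c + m) k).1.num.toNat : ℤ) = (pt (c + m) k).1.num :=
    Int.toNat_of_nonneg (Rat.num_nonneg.2 (pt (c + m) k).2.1)
  -- Here `2 ^ c` is the factor cancelled in reducing `k / 2ⁿ`; `deg_nodalCubic_pow_mul` shows that
  -- it changes the colength only by `(2 ^ c)³`.
  have hk' : k = 2 ^ c * (pt (c + m) k).1.num.toNat := by
    have h1 := Rat.num_div_den (pt (c + m) k).1
    rw [hden, ← hnum] at h1
    conv_rhs at h1 => rw [hc, pow_add]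
    push_cast at h1
    field_simp at h1
    have h2 : (2 ^ c * (pt (c + m) k).1.num.toNat : ℚ) = k := by linear_combination h1
    exact_mod_cast h2.symm
  rw [hkFun, hden, Fintype.card_fin]
  conv_lhs => rw [hk', pow_add 2 c m, deg_nodalCubic_pow_mul]
  push_cast
  rw [pow_add]
  field_simp

lemma deg_uvNodalCubic_two_pow (hF : NodalCubicConjecture F) (n : ℕ) :
    (deg (2 ^ n) (uvNodalCubic F) : ℚ)
      = (2 ^ n) ^ 3 * (2 ^ n + 2 * dyadicSum (phi 0) n) := by
  have hφ {k : ℕ} (hk : k ≤ 2 ^ n) : (deg (2 ^ n) (nodalCubic F ^ k) : ℚ)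
      = (2 ^ n) ^ 3 * (idFun (pt n k) + phi 0 (pt n k)) := by
    rw [deg_nodalCubic_pow hk, show hkFun (nodalCubic F) = _ from hF, Pi.add_apply]
  obtain ⟨N, hN⟩ := Nat.exists_eq_succ_of_ne_zero (pow_ne_zero n (two_ne_zero (α := ℕ)))
  -- The exponents here run over `1, …, 2ⁿ - 1`; the missing `k = 0` term of the dyadic sums is
  -- zero.
  have hsum : ∑ k ∈ Finset.range (2 ^ n - 1), (deg (2 ^ n) (nodalCubic F ^ (k + 1)) : ℚ)
      = (2 ^ n) ^ 3 * (dyadicSum idFun n + dyadicSum (phi 0) n) := by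
    rw [dyadicSum, dyadicSum, ← Finset.sum_add_distrib, Finset.mul_sum]
    conv_rhs => rw [hN, Finset.sum_range_succ', pt_zero, phi_zeroPt]
    rw [hN, Nat.succ_sub_one, show idFun zeroPt = 0 from rfl, add_zero, mul_zero, add_zero, ← hN]
    refine Finset.sum_congr rfl fun k hk => hφ ?_
    have := Finset.mem_range.1 hk
    omega
  have hlast : (deg (2 ^ n) (nodalCubic F ^ 2 ^ n) : ℚ) = (2 ^ n) ^ 3 := by
    rw [hφ le_rfl, pt_two_pow, phi_onePt, show idFun onePt = 1 from rfl]
    ring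
  have hsplit : ∑ k ∈ Finset.range (2 ^ n), (deg (2 ^ n) (nodalCubic F ^ (k + 1)) : ℚ)
      = ∑ k ∈ Finset.range (2 ^ n - 1), (deg (2 ^ n) (nodalCubic F ^ (k + 1)) : ℚ)
        + (2 ^ n) ^ 3 := by
    rw [← hlast]
    conv_lhs => rw [hN, Finset.sum_range_succ, ← Nat.succ_eq_add_one N, ← hN]
    rw [show 2 ^ n - 1 = N by omega]
  -- The unpaired top term `(2ⁿ)³` cancels the `-1` in `2 ∑ k/2ⁿ = 2ⁿ - 1`.
  rw [deg_uvNodalCubic]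
  push_cast
  rw [hsplit, hsum, dyadicSum_idFun]
  ring

lemma hasHKMultiplicity_uvNodalCubic (hF : NodalCubicConjecture F) :
    HasHKMultiplicity (uvNodalCubic F) (4 / 3 + 5 / (14 * √7)) := by
  have h := (tendsto_dyadicSum_phi 0).const_add 1
  rw [phiLimit_zero, show (1 : ℝ) + (1 / 3 + 5 / (14 * √7)) = 4 / 3 + 5 / (14 * √7) by ring] at h
  refine h.congr fun n => ?_
  have hd : (deg (2 ^ n) (uvNodalCubic F) : ℝ)
      = (2 ^ n) ^ 3 * (2 ^ n + 2 * (dyadicSum (phi 0) n : ℝ)) := by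
    exact_mod_cast congrArg (Rat.cast : ℚ → ℝ) (deg_uvNodalCubic_two_pow hF n)
  rw [hd, Fintype.card_fin, show 5 - 1 = 4 from rfl]
  field_simp

end NodalCubic

end HilbertKunz

theorem theorem2p4 :
    Filter.Tendsto (fun n : ℕ => (2 : ℝ) ^ n * (HilbertKunz.E₁ (HilbertKunz.invTwoPow n) : ℝ))
        Filter.atTop (nhds (1 / 3 + 5 / (14 * Real.sqrt 7))) ∧
      ∀ (F : Type*) [Field F] [CharP F 2], HilbertKunz.NodalCubicConjecture F →
        HilbertKunz.HasHKMultiplicity (HilbertKunz.uvNodalCubic F)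
          (4 / 3 + 5 / (14 * Real.sqrt 7)) :=
  ⟨HilbertKunz.tendsto_E₁, fun _ _ _ hF => HilbertKunz.hasHKMultiplicity_uvNodalCubic hF⟩
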